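/- For a complex $n\times n$ matrix $x$ with no eigenvalue in $]-\infty,0]$, let $\log(x)$ denote its principal logarithm, i.e. the unique complex $n\times n$ matrix $a$ such that $e^a=x$ and every eigenvalue $z$ of $a$ satisfies $-\pi<\operatorname{Im}(z)<\pi$. Let $x,y$ be complex $n\times n$ matrices such that none of $x$, $y$, $xy$ has an eigenvalue in $]-\infty,0]$, and such that $\log(xy)=\log(x)+\log(y)$. If $x$ and $y$ are simultaneously triangularizable, i.e. there is an invertible complex $n\times n$ matrix $P$ such that $P^{-1}xP$ and $P^{-1}yP$ are both upper triangular, then $xy=yx$. -/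

import Mathlib

/-- No eigenvalue of the complex matrix `x` lies in the half-line `]-∞, 0]`. -/
def NoNonposEigenvalue {n : ℕ} (x : Matrix (Fin n) (Fin n) ℂ) : Prop :=
  ∀ t : ℝ, t ≤ 0 → (t : ℂ) ∉ spectrum ℂ x

/-- `a` is a principal logarithm of `x`: `e ^ a = x`, and every eigenvalue of `a` lies in the open
strip `Im z ∈ ]-π, π[`. -/
def IsPrincipalLog {n : ℕ} (x a : Matrix (Fin n) (Fin n) ℂ) : Prop :=
  NormedSpace.exp a = x ∧ ∀ z ∈ spectrum ℂ a, -Real.pi < z.im ∧ z.im < Real.pi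

open Classical in
/-- The principal logarithm of a complex square matrix: the matrix `a` with `IsPrincipalLog x a`.
If `x` has no eigenvalue in `]-∞, 0]`, such a matrix exists and is unique; the value `0` is a
placeholder for matrices that have no principal logarithm. -/
noncomputable def principalLog {n : ℕ} (x : Matrix (Fin n) (Fin n) ℂ) : Matrix (Fin n) (Fin n) ℂ :=
  if h : ∃ a, IsPrincipalLog x a then h.choose else 0

/-- `x` and `y` are simultaneously triangularizable: a single change of basis makes both
upper triangular. -/
def SimultaneouslyTriangularizable {n : ℕ} (x y : Matrix (Fin n) (Fin n) ℂ) : Prop :=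
  ∃ P : Matrix (Fin n) (Fin n) ℂ, IsUnit P ∧
    (P⁻¹ * x * P).BlockTriangular id ∧ (P⁻¹ * y * P).BlockTriangular id

/-! Put a = log x and b = log y. Then e^(a+b) = e^a e^b, the eigenvalues of a, b and a + b lie in
the strip |Im| < π, and it suffices that a and b commute. The principal logarithm is an integral of
resolvents (`segmentLog`), so a and b are upper triangular in the given basis. By induction on the
size, C = ab - ba lives in the top right corner. Hence aC = a₁C and Ca = a₂C, where a₁ and a₂ are
the first and last diagonal entries of a, and likewise for b.

Let ψ(z) = (e^z - 1)/z, α = a₁ - a₂, β = b₁ - b₂. Then [e^a, b] = e^(a₂) ψ(α) C (`exp_commutator`).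
Suppose C ≠ 0. As e^a e^b commutes with a + b, ψ(β) = ψ(-α). As e^(a+b) e^(-b) = e^a commutes with
a, ψ(-(α+β)) = ψ(-β). The imaginary parts of α, β and α + β are below 2π in absolute value, so
`expSlope_injective` gives α + β = 0 and then α = 0. Now a and b commute with C, and e^(-(a+b)) e^a
e^b = 1 + C/2, so C = 0 (`commutator_eq_zero_of_central`).

Injectivity of ψ rests on a bound for its argument: it lies strictly between 0 and Im z when 0 < Im
z < 2π (`exists_expSlope_eq`). -/

/-! ### Injectivity of (e^z - 1)/z on strips -/

/-- The entire function `(e ^ z - 1) / z`, with value `1` at `0`. -/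
noncomputable def expSlope (z : ℂ) : ℂ := if z = 0 then 1 else (Complex.exp z - 1) / z

theorem expSlope_zero : expSlope 0 = 1 := if_pos rfl

theorem expSlope_of_ne_zero {z : ℂ} (hz : z ≠ 0) : expSlope z = (Complex.exp z - 1) / z :=
  if_neg hz

theorem mul_expSlope (z : ℂ) : z * expSlope z = Complex.exp z - 1 := by
  by_cases hz : z = 0
  · simp [hz]
  · rw [expSlope_of_ne_zero hz, mul_div_cancel₀ _ hz]

theorem expSlope_conj (z : ℂ) :
    expSlope ((starRingEnd ℂ) z) = (starRingEnd ℂ) (expSlope z) := by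
  by_cases hz : z = 0
  · simp [hz, expSlope_zero]
  · rw [expSlope_of_ne_zero hz, expSlope_of_ne_zero (by simpa using hz), Complex.exp_conj]
    simp

theorem sinh_le_mul_cosh {x : ℝ} (hx : 0 ≤ x) : Real.sinh x ≤ x * Real.cosh x := by
  have hd : ∀ t : ℝ, HasDerivAt (fun t => t * Real.cosh t - Real.sinh t) (t * Real.sinh t) t := by
    intro t
    exact (((hasDerivAt_id' t).mul (Real.hasDerivAt_cosh t)).sub
      (Real.hasDerivAt_sinh t)).congr_deriv (by ring)
  have hm : MonotoneOn (fun t => t * Real.cosh t - Real.sinh t) (Set.Ici 0) := by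
    apply monotoneOn_of_deriv_nonneg (convex_Ici 0)
    · exact fun t _ => (hd t).continuousAt.continuousWithinAt
    · exact fun t _ => (hd t).differentiableAt.differentiableWithinAt
    · intro t ht
      rw [interior_Ici, Set.mem_Ioi] at ht
      rw [(hd t).deriv]
      exact mul_nonneg ht.le (Real.sinh_nonneg_iff.2 ht.le)
  have := hm Set.self_mem_Ici hx hx
  simp at this
  linarith

/-- The bound `|arg (sinh u / u)| < Im u` in the strip `0 < Im u < π`, in Cartesian form. -/
theorem sqrt_mul_cos_lt {x v : ℝ} (hv : 0 < v) (hv' : v < Real.pi) :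
    √((x ^ 2 + v ^ 2) * (Real.sinh x ^ 2 + Real.sin v ^ 2)) * Real.cos v <
      x * Real.sinh x * Real.cos v + v * Real.cosh x * Real.sin v := by
  wlog hx : 0 ≤ x generalizing x
  · simpa using this (x := -x) (by linarith)
  have hs : 0 ≤ Real.sinh x := Real.sinh_nonneg_iff.2 hx
  have hxs : x ≤ Real.sinh x := Real.self_le_sinh_iff.2 hx
  have hsc := sinh_le_mul_cosh hx
  have hc : 1 ≤ Real.cosh x := Real.one_le_cosh x
  have hσ : 0 < Real.sin v := Real.sin_pos_of_pos_of_lt_pi hv hv'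
  have hcs := Real.cosh_sq x
  have hCσ := Real.sin_sq_add_cos_sq v
  have hpos : 0 < v * Real.cosh x * Real.sin v := by positivity
  rcases le_or_gt (Real.cos v) 0 with hC | hC
  · have h1 : x * Real.sinh x ≤ √((x ^ 2 + v ^ 2) * (Real.sinh x ^ 2 + Real.sin v ^ 2)) := by
      apply Real.le_sqrt_of_sq_le
      rw [mul_pow]
      gcongr
      · linarith [sq_nonneg v]
      · linarith [sq_nonneg (Real.sin v)]
    nlinarith [mul_le_mul_of_nonpos_right h1 hC]
  · have hv2 : v < Real.pi / 2 := by
      by_contra! h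
      exact absurd (Real.cos_nonpos_of_pi_div_two_le_of_le h (by linarith)) (not_le.2 hC)
    have hT : v * Real.cos v ≤ Real.sin v := by
      have := Real.le_tan hv.le hv2
      rwa [Real.tan_eq_sin_div_cos, le_div_iff₀ hC] at this
    have hσv : Real.sin v ≤ v := Real.sin_le hv.le
    have hC1 := Real.cos_le_one v
    -- Since cos v > 0, both sides can be squared. The difference of squares is a sum of two gaps
    -- and a positive remainder; the gaps are nonnegative by sinh x ≤ x cosh x, v cos v ≤ sin v, x ≤
    -- sinh x and sin v ≤ v.
    rw [← Real.sqrt_sq hC.le, ← Real.sqrt_mul (by positivity), Real.sqrt_sq hC.le]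
    rw [Real.sqrt_lt' (by positivity)]
    generalize Real.sinh x = s at *
    generalize Real.cosh x = c at *
    generalize Real.sin v = σ at *
    generalize Real.cos v = C at *
    have e1 : (s * (v * C)) * s ≤ (x * c * σ) * s := by
      gcongr
    have f1 : (s * (v * C)) * s * (v * C) ≤ (x * c * σ) * s * (v * C) := by
      gcongr
    have f2 : (x * (C * σ)) * x * (C * σ) ≤ (s * (1 * v)) * (x * c) * (C * σ) := by
      gcongr
      exact le_mul_of_one_le_right hx hc
    have f3 : 0 < v ^ 2 * σ ^ 4 + s ^ 2 * v ^ 2 * σ ^ 2 := by positivity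
    have key : (x * s * C + v * c * σ) ^ 2 - (x ^ 2 + v ^ 2) * (s ^ 2 + σ ^ 2) * C ^ 2 =
        ((x * c * σ) * s * (v * C) - (s * (v * C)) * s * (v * C)) +
        ((s * (1 * v)) * (x * c) * (C * σ) - (x * (C * σ)) * x * (C * σ)) +
        (v ^ 2 * σ ^ 4 + s ^ 2 * v ^ 2 * σ ^ 2) := by
      have hC2 : C ^ 2 = 1 - σ ^ 2 := by linarith
      linear_combination (v ^ 2 * σ ^ 2) * hcs + (- v ^ 2 * σ ^ 2) * hC2
    linarith

/-- In the strip `0 < Im z < 2π`, the argument of `(e ^ z - 1) / z` lies between `0` and `Im z`. -/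
theorem exists_expSlope_eq {z : ℂ} (h0 : 0 < z.im) (h1 : z.im < 2 * Real.pi) :
    ∃ r θ : ℝ, 0 < r ∧ 0 < θ ∧ θ < z.im ∧ expSlope z = r * Complex.exp (θ * Complex.I) := by
  -- ψ(2u) = e^u · sinh u / u. The factor e^u contributes Im u = Im z / 2 to the argument, so it
  -- remains to see that |arg (sinh u / u)| < Im u.
  set u : ℂ := z / 2 with hu
  have hzu : z = 2 * u := by rw [hu]; ring
  set x := u.re with hx
  set v := u.im with hv
  have hzv : z.im = 2 * v := by rw [hzu]; simp [hv]
  have hv0 : 0 < v := by linarith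
  have hvpi : v < Real.pi := by linarith
  have hu0 : u ≠ 0 := by
    intro h
    rw [h, Complex.zero_im] at hv
    linarith
  have hz0 : z ≠ 0 := by rw [hzu]; simpa using hu0
  set S : ℂ := Complex.sinh u / u with hS
  have hψ : expSlope z = Complex.exp u * S := by
    rw [expSlope_of_ne_zero hz0, hS, Complex.sinh, hzu, two_mul, Complex.exp_add, Complex.exp_neg]
    have := Complex.exp_ne_zero u
    field_simp
    norm_num
  have hue : u = x + v * Complex.I := (Complex.re_add_im u).symm
  have hsre : (Complex.sinh u).re = Real.sinh x * Real.cos v := by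
    rw [hue, Complex.sinh_add, Complex.sinh_mul_I, Complex.cosh_mul_I, ← Complex.ofReal_sinh,
      ← Complex.ofReal_cosh, ← Complex.ofReal_sin, ← Complex.ofReal_cos]
    simp only [Complex.add_re, Complex.mul_re, Complex.mul_im, Complex.ofReal_re,
      Complex.ofReal_im, Complex.I_re, Complex.I_im]
    ring
  have hsim : (Complex.sinh u).im = Real.cosh x * Real.sin v := by
    rw [hue, Complex.sinh_add, Complex.sinh_mul_I, Complex.cosh_mul_I, ← Complex.ofReal_sinh,
      ← Complex.ofReal_cosh, ← Complex.ofReal_sin, ← Complex.ofReal_cos]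
    simp only [Complex.add_im, Complex.mul_re, Complex.mul_im, Complex.ofReal_re,
      Complex.ofReal_im, Complex.I_re, Complex.I_im]
    ring
  have hnu : Complex.normSq u = x ^ 2 + v ^ 2 := by rw [Complex.normSq_apply]; ring
  have hns : Complex.normSq (Complex.sinh u) = Real.sinh x ^ 2 + Real.sin v ^ 2 := by
    rw [Complex.normSq_apply, hsre, hsim]
    linear_combination Real.sin v ^ 2 * Real.cosh_sq x +
      Real.sinh x ^ 2 * Real.sin_sq_add_cos_sq v
  have hnpos : 0 < x ^ 2 + v ^ 2 := by positivity
  have hRe : S.re * (x ^ 2 + v ^ 2) =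
      x * Real.sinh x * Real.cos v + v * Real.cosh x * Real.sin v := by
    rw [hS, Complex.div_re, hnu, hsre, hsim, ← hx, ← hv]
    field_simp
  have hnorm : ‖S‖ * (x ^ 2 + v ^ 2) =
      √((x ^ 2 + v ^ 2) * (Real.sinh x ^ 2 + Real.sin v ^ 2)) := by
    rw [hS, norm_div, Complex.norm_def, Complex.norm_def, hnu, hns,
      Real.sqrt_mul hnpos.le]
    have := Real.sqrt_pos.2 hnpos
    have h2 := Real.mul_self_sqrt hnpos.le
    rw [div_mul_eq_mul_div, div_eq_iff this.ne', mul_right_comm, h2, mul_comm]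
  have hlt : ‖S‖ * Real.cos v < S.re := by
    have := sqrt_mul_cos_lt (x := x) hv0 hvpi
    rw [← hRe, ← hnorm, mul_right_comm] at this
    exact lt_of_mul_lt_mul_right this hnpos.le
  have hSpos : 0 < ‖S‖ := by
    rw [norm_pos_iff]
    rintro h
    simp [h] at hlt
  have harg : |S.arg| < v := by
    rw [← Complex.norm_mul_cos_arg S] at hlt
    have hc := lt_of_mul_lt_mul_left hlt hSpos.le
    rw [← Real.cos_abs S.arg] at hc
    by_contra! h
    exact absurd (Real.cos_le_cos_of_nonneg_of_le_pi hv0.le (Complex.abs_arg_le_pi S) h)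
      (not_le.2 hc)
  rw [abs_lt] at harg
  refine ⟨Real.exp x * ‖S‖, v + S.arg, by positivity, by linarith, by linarith, ?_⟩
  rw [hψ]
  conv_lhs => rw [← Complex.norm_mul_exp_arg_mul_I S, hue]
  push_cast
  rw [Complex.exp_add, add_mul (v : ℂ), Complex.exp_add]
  ring

theorem expSlope_ofReal (t : ℝ) : ∃ r : ℝ, 0 < r ∧ expSlope t = r := by
  rcases lt_trichotomy t 0 with h | h | h
  · refine ⟨(Real.exp t - 1) / t, div_pos_of_neg_of_neg (by simpa using h) h, ?_⟩
    rw [expSlope_of_ne_zero (by exact_mod_cast h.ne)]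
    push_cast; rfl
  · exact ⟨1, one_pos, by simp [h, expSlope_zero]⟩
  · refine ⟨(Real.exp t - 1) / t, div_pos (by simpa using h) h, ?_⟩
    rw [expSlope_of_ne_zero (by exact_mod_cast h.ne')]
    push_cast; rfl

theorem exists_expSlope_eq_of_nonneg {z : ℂ} (h0 : 0 ≤ z.im) (h1 : z.im < 2 * Real.pi) :
    ∃ r θ : ℝ, 0 < r ∧ 0 ≤ θ ∧ θ ≤ z.im ∧ (0 < z.im → 0 < θ ∧ θ < z.im) ∧
      expSlope z = r * Complex.exp (θ * Complex.I) := by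
  rcases h0.eq_or_lt with h | h
  · obtain ⟨r, hr, hr'⟩ := expSlope_ofReal z.re
    have hz : (z.re : ℂ) = z := Complex.ext (by simp) (by simp [← h])
    exact ⟨r, 0, hr, le_rfl, h0, fun h' => absurd h h'.ne, by rw [← hz, hr']; simp⟩
  · obtain ⟨r, θ, hr, h2, h3, h4⟩ := exists_expSlope_eq h h1
    exact ⟨r, θ, hr, h2.le, h3.le, fun _ => ⟨h2, h3⟩, h4⟩

theorem expSlope_ne_zero {z : ℂ} (h : |z.im| < 2 * Real.pi) : expSlope z ≠ 0 := by
  have aux : ∀ w : ℂ, 0 ≤ w.im → w.im < 2 * Real.pi → expSlope w ≠ 0 := by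
    intro w h0 h1
    obtain ⟨r, θ, hr, -, -, -, h4⟩ := exists_expSlope_eq_of_nonneg h0 h1
    rw [h4]
    exact mul_ne_zero (by exact_mod_cast hr.ne') (Complex.exp_ne_zero _)
  rw [abs_lt] at h
  rcases le_total 0 z.im with h0 | h0
  · exact aux z h0 h.2
  · have := aux ((starRingEnd ℂ) z) (by simpa using h0) (by simpa using by linarith)
    rw [expSlope_conj] at this
    simpa using this

/-- A common value r puts (0, 1), (s, e^s) and (t, e^t) on one line of slope r, against the strict
convexity of exp. If s or t is 0, that line is the tangent at 0. -/
theorem expSlope_ofReal_injective {s t : ℝ} (h : expSlope s = expSlope t) : s = t := by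
  have hs := mul_expSlope s
  have ht := mul_expSlope t
  obtain ⟨r, hr, hr'⟩ := expSlope_ofReal s
  rw [← h] at ht
  rw [hr'] at hs ht
  have hs' : Real.exp s = 1 + s * r := by
    have : ((s * r : ℝ) : ℂ) = ((Real.exp s - 1 : ℝ) : ℂ) := by push_cast; exact hs
    linarith [Complex.ofReal_injective this]
  have ht' : Real.exp t = 1 + t * r := by
    have : ((t * r : ℝ) : ℂ) = ((Real.exp t - 1 : ℝ) : ℂ) := by push_cast; exact ht
    linarith [Complex.ofReal_injective this]
  have key : ∀ {s t r : ℝ}, Real.exp s = 1 + s * r → Real.exp t = 1 + t * r → s ≠ 0 → t ≠ 0 →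
      ¬ s < t := by
    intro s t r hs' ht' hs0 ht0 hlt
    have := strictConvexOn_exp.secant_strict_mono (Set.mem_univ 0) (Set.mem_univ s)
      (Set.mem_univ t) hs0 ht0 hlt
    rw [hs', ht', Real.exp_zero, sub_zero, sub_zero, add_sub_cancel_left, add_sub_cancel_left,
      mul_div_cancel_left₀ _ hs0, mul_div_cancel_left₀ _ ht0] at this
    exact lt_irrefl _ this
  have key0 : ∀ {t : ℝ}, expSlope t = 1 → t = 0 := by
    intro t h1
    by_contra ht0
    have h2 := mul_expSlope t
    rw [h1, mul_one] at h2
    have h3 : t = Real.exp t - 1 := by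
      apply Complex.ofReal_injective
      push_cast
      exact h2
    linarith [Real.add_one_lt_exp ht0]
  by_cases hs0 : s = 0
  · rw [hs0, Complex.ofReal_zero, expSlope_zero] at h
    rw [hs0, key0 h.symm]
  by_cases ht0 : t = 0
  · rw [ht0, Complex.ofReal_zero, expSlope_zero] at h
    rw [ht0, key0 h]
  have hst := not_lt.1 (key ht' hs' ht0 hs0)
  have hts := not_lt.1 (key hs' ht' hs0 ht0)
  exact le_antisymm hst hts

/-- The case of `expSlope_injective` in which `0` separates the imaginary parts. -/
theorem expSlope_injective_of_separated {p q : ℂ} (hp : p.im ≤ 0) (hq : 0 ≤ q.im)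
    (hpq : q.im - p.im < 2 * Real.pi) (h : expSlope p = expSlope q) : p = q := by
  obtain ⟨r, θ, hr, h1, h2, h3, h4⟩ := exists_expSlope_eq_of_nonneg hq (by linarith)
  obtain ⟨r', θ', hr', h1', h2', h3', h4'⟩ :=
    exists_expSlope_eq_of_nonneg (z := (starRingEnd ℂ) p) (by simpa using hp)
      (by simpa using by linarith)
  rw [Complex.conj_im] at h2' h3'
  rw [expSlope_conj, h, h4] at h4'
  -- The arguments θ of ψ(q) and -θ' of ψ(p) lie on opposite sides of 0, and θ + θ' < 2π. Equality
  -- of the values forces θ + θ' = 0, hence p and q are real.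
  have hE : (r : ℂ) = r' * Complex.exp ((θ' + θ : ℝ) * Complex.I) := by
    have h5 : (r : ℂ) * Complex.exp (-(θ * Complex.I)) = r' * Complex.exp (θ' * Complex.I) := by
      rw [← h4', map_mul, Complex.conj_ofReal, ← Complex.exp_conj]
      simp
    calc (r : ℂ) = r * Complex.exp (-(θ * Complex.I)) * Complex.exp (θ * Complex.I) := by
          rw [mul_assoc, ← Complex.exp_add]; simp
      _ = _ := by rw [h5, mul_assoc, ← Complex.exp_add]; push_cast; ring_nf
  have hrr : r = r' := by
    have := congrArg norm hE
    rwa [norm_mul, Complex.norm_exp_ofReal_mul_I, mul_one, Complex.norm_of_nonneg hr.le,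
      Complex.norm_of_nonneg hr'.le] at this
  have hcos : Real.cos (θ' + θ) = 1 := by
    have := congrArg Complex.re hE
    rw [Complex.re_ofReal_mul, Complex.exp_ofReal_mul_I_re, Complex.ofReal_re, hrr] at this
    exact mul_left_cancel₀ hr'.ne' (by rw [← this, mul_one])
  have hsum := (Real.cos_eq_one_iff_of_lt_of_lt (by linarith [Real.pi_pos]) (by linarith)).1 hcos
  have hq0 : q.im = 0 := by
    by_contra hne
    linarith [(h3 (lt_of_le_of_ne hq (Ne.symm hne))).1]
  have hp0 : p.im = 0 := by
    by_contra hne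
    linarith [(h3' (neg_pos.2 (lt_of_le_of_ne hp hne))).1]
  have hp' : (p.re : ℂ) = p := Complex.ext (by simp) (by simp [hp0])
  have hq' : (q.re : ℂ) = q := Complex.ext (by simp) (by simp [hq0])
  rw [← hp', ← hq'] at h ⊢
  rw [expSlope_ofReal_injective h]

theorem expSlope_neg (p : ℂ) : expSlope (-p) = Complex.exp (-p) * expSlope p := by
  by_cases hp : p = 0
  · simp [hp]
  · rw [expSlope_of_ne_zero hp, expSlope_of_ne_zero (neg_ne_zero.2 hp), Complex.exp_neg]
    have := Complex.exp_ne_zero p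
    field_simp
    ring

/-- The points over 0, p and q on the graph of exp are collinear, so the slope can be measured from
p instead of 0; dividing by e^p moves p to the origin. -/
theorem expSlope_sub_of_eq {p q : ℂ} (h : expSlope p = expSlope q) (hne : p ≠ q) :
    expSlope (q - p) = expSlope (-p) := by
  have hp := mul_expSlope p
  have hq := mul_expSlope q
  rw [← h] at hq
  have hqp : q - p ≠ 0 := sub_ne_zero.2 hne.symm
  rw [expSlope_neg, expSlope_of_ne_zero hqp, div_eq_iff hqp, sub_eq_add_neg q p, Complex.exp_add,
    Complex.exp_neg]
  have := Complex.exp_ne_zero p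
  field_simp
  linear_combination hp - hq

/-- The function `(e ^ z - 1) / z` takes distinct values at two points whose imaginary parts,
and the difference of these, are less than `2π` in absolute value. -/
theorem expSlope_injective {p q : ℂ} (hp : |p.im| < 2 * Real.pi) (hq : |q.im| < 2 * Real.pi)
    (hpq : |p.im - q.im| < 2 * Real.pi) (h : expSlope p = expSlope q) : p = q := by
  -- For imaginary parts of the same sign, translation by -p yields the points -p and q - p with
  -- equal ψ, now separated by 0. The separated case would make them equal, that is, q = 0.
  have between : ∀ {p q : ℂ}, |q.im| < 2 * Real.pi → expSlope p = expSlope q → q ≠ 0 →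
      (0 ≤ p.im ∧ p.im ≤ q.im ∨ q.im ≤ p.im ∧ p.im ≤ 0) → p = q := by
    intro p q hq h hq0 hor
    by_contra hne
    rw [abs_lt] at hq
    have hs := expSlope_sub_of_eq h hne
    rcases hor with ⟨h1, h2⟩ | ⟨h1, h2⟩
    · have := expSlope_injective_of_separated (p := -p) (q := q - p) (by simpa using h1)
        (by simpa using h2) (by simpa using by linarith) hs.symm
      exact hq0 (by linear_combination -this)
    · have := expSlope_injective_of_separated (p := q - p) (q := -p) (by simpa using h1)
        (by simpa using h2) (by simpa using by linarith) hs
      exact hq0 (by linear_combination this)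
  have hp' := abs_lt.1 hp
  have hq' := abs_lt.1 hq
  have hpq' := abs_lt.1 hpq
  rcases le_total p.im 0 with h1 | h1 <;> rcases le_total q.im 0 with h2 | h2
  · by_cases hp0 : p = 0
    · exact (expSlope_injective_of_separated h2 (by simp [hp0]) (by linarith) h.symm).symm
    by_cases hq0 : q = 0
    · exact expSlope_injective_of_separated h1 (by simp [hq0]) (by linarith) h
    rcases le_total p.im q.im with h3 | h3
    · exact (between hp h.symm hp0 (Or.inr ⟨h3, h2⟩)).symm
    · exact between hq h hq0 (Or.inr ⟨h3, h1⟩)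
  · exact expSlope_injective_of_separated h1 h2 (by linarith) h
  · exact (expSlope_injective_of_separated h2 h1 (by linarith) h.symm).symm
  · by_cases hp0 : p = 0
    · exact expSlope_injective_of_separated (by simp [hp0]) h2 (by linarith) h
    by_cases hq0 : q = 0
    · exact (expSlope_injective_of_separated (by simp [hq0]) h1 (by linarith) h.symm).symm
    rcases le_total p.im q.im with h3 | h3
    · exact between hq h hq0 (Or.inl ⟨h1, h3⟩)
    · exact (between hp h.symm hp0 (Or.inl ⟨h2, h3⟩)).symm

/-! ### Commutators with exponentials -/

section BanachAlgebra

variable {A E : Type*} [NormedRing A] [NormedAlgebra ℂ A] [CompleteSpace A]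
  [NormedAddCommGroup E] [NormedSpace ℂ E]

theorem ContinuousLinearMap.map_exp_of_map_pow (φ : A →L[ℂ] E) {a : A} {s : ℂ}
    (h : ∀ k : ℕ, φ (a ^ k) = s ^ k • φ 1) : φ (NormedSpace.exp a) = Complex.exp s • φ 1 := by
  have h1 := (NormedSpace.exp_series_hasSum_exp' (𝕂 := ℂ) a).mapL φ
  have h2 := (NormedSpace.exp_series_hasSum_exp' (𝕂 := ℂ) s).smul_const (φ 1)
  rw [← Complex.exp_eq_exp_ℂ] at h2
  refine h1.unique (h2.congr_fun fun k => ?_)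
  simp [h, smul_smul]

theorem exp_mul_of_mul_eq_smul {a C : A} {s : ℂ} (h : a * C = s • C) :
    NormedSpace.exp a * C = Complex.exp s • C := by
  have := ((ContinuousLinearMap.mul ℂ A).flip C).map_exp_of_map_pow (a := a) (s := s) (by
    intro k
    induction k with
    | zero => simp
    | succ k ih =>
      simp only [ContinuousLinearMap.flip_apply, ContinuousLinearMap.mul_apply', one_mul] at ih ⊢
      rw [pow_succ, mul_assoc, h, mul_smul_comm, ih, smul_smul, pow_succ'])
  simpa using this

theorem mul_exp_of_mul_eq_smul {a C : A} {s : ℂ} (h : C * a = s • C) :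
    C * NormedSpace.exp a = Complex.exp s • C := by
  have := ((ContinuousLinearMap.mul ℂ A) C).map_exp_of_map_pow (a := a) (s := s) (by
    intro k
    induction k with
    | zero => simp
    | succ k ih =>
      simp only [ContinuousLinearMap.mul_apply', mul_one] at ih ⊢
      rw [pow_succ', ← mul_assoc, h, smul_mul_assoc, ih, smul_smul, pow_succ'])
  simpa using this

theorem exp_neg_mul_exp (a : A) : NormedSpace.exp (-a) * NormedSpace.exp a = 1 := by
  have : Commute (-a) a := (Commute.refl a).neg_left
  let _ := NormedAlgebra.restrictScalars ℚ ℂ A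
  rw [← NormedSpace.exp_add_of_commute this, neg_add_cancel, NormedSpace.exp_zero]

theorem exp_mul_exp_neg (a : A) : NormedSpace.exp a * NormedSpace.exp (-a) = 1 := by
  simpa using exp_neg_mul_exp (-a)

/-- If `[a, m]` commutes with `a`, then `[e ^ a, m] = e ^ a * [a, m]`. -/
theorem exp_commutator_of_commute {a m C : A} (hC : a * m - m * a = C) (h : Commute a C) :
    NormedSpace.exp a * m - m * NormedSpace.exp a = NormedSpace.exp a * C := by
  -- Conjugation by e^(ta) moves m along a line: e^(-ta) m e^(ta) = m - tC.
  let G : ℂ → A := fun t => NormedSpace.exp (t • (-a)) * m * NormedSpace.exp (t • a) + t • C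
  have hG : ∀ t, HasDerivAt G 0 t := by
    intro t
    have h1 := (((hasDerivAt_exp_smul_const (𝕂 := ℂ) (-a) t).mul_const m).mul
      (hasDerivAt_exp_smul_const' (𝕂 := ℂ) a t)).add ((hasDerivAt_id t).smul_const C)
    refine h1.congr_deriv ?_
    have hc : Commute C (NormedSpace.exp (t • a)) := (h.symm.smul_right t).exp_right
    have h2 : NormedSpace.exp (t • -a) * NormedSpace.exp (t • a) = 1 := by
      rw [smul_neg, exp_neg_mul_exp]
    calc _ = -(NormedSpace.exp (t • -a) * ((a * m - m * a) * NormedSpace.exp (t • a))) + C := by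
          simp only [one_smul]; noncomm_ring
      _ = 0 := by rw [hC, hc.eq, ← mul_assoc, h2, one_mul, neg_add_cancel]
  have hconst := is_const_of_deriv_eq_zero (fun t => (hG t).differentiableAt)
    (fun t => (hG t).deriv) 1 0
  simp only [G, one_smul, zero_smul, NormedSpace.exp_zero, one_mul, mul_one, add_zero] at hconst
  have := congrArg (NormedSpace.exp a * ·) hconst
  simp only [mul_add, ← mul_assoc, exp_mul_exp_neg, one_mul] at this
  rw [← this]
  abel

/-- The commutator `[e ^ a, m]` when `C = [a, m]` is an eigenvector of left and right
multiplication by `a`. -/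
theorem exp_commutator {a m C : A} {s t : ℂ} (hC : a * m - m * a = C) (hl : a * C = s • C)
    (hr : C * a = t • C) :
    NormedSpace.exp a * m - m * NormedSpace.exp a =
      (Complex.exp t * expSlope (s - t)) • C := by
  by_cases hst : s = t
  · subst hst
    rw [exp_commutator_of_commute hC (hl.trans hr.symm), exp_mul_of_mul_eq_smul hl]
    simp [expSlope_zero]
  · have hne : s - t ≠ 0 := sub_ne_zero.2 hst
    -- Since [a, C] = (s - t)C, subtracting this multiple of C from m cancels [a, m].
    have hcomm : Commute a (m - (s - t)⁻¹ • C) := by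
      rw [commute_iff_eq, ← sub_eq_zero]
      calc _ = (a * m - m * a) - (s - t)⁻¹ • (a * C - C * a) := by
            rw [mul_sub, sub_mul, mul_smul_comm, smul_mul_assoc, smul_sub]; abel
        _ = 0 := by rw [hC, hl, hr, ← sub_smul, smul_smul, inv_mul_cancel₀ hne, one_smul, sub_self]
    have h1 := hcomm.exp_left.eq
    rw [mul_sub, sub_mul, mul_smul_comm, smul_mul_assoc, exp_mul_of_mul_eq_smul hl,
      mul_exp_of_mul_eq_smul hr, sub_eq_sub_iff_sub_eq_sub, ← smul_sub, ← sub_smul, smul_smul] at h1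
    rw [h1, expSlope_of_ne_zero hne]
    congr 1
    rw [Complex.exp_sub]
    have := Complex.exp_ne_zero t
    field_simp

/-- If `[a, b] = C` with `a`, `b` acting on `C` by the same scalars on both sides, then
`e ^ (a + b) = e ^ a * e ^ b` forces `C = 0`. -/
theorem commutator_eq_zero_of_central {a b C : A} {s t : ℂ} (hC : a * b - b * a = C)
    (hal : a * C = s • C) (har : C * a = s • C) (hbl : b * C = t • C) (hbr : C * b = t • C)
    (h : NormedSpace.exp (a + b) = NormedSpace.exp a * NormedSpace.exp b) : C = 0 := by
  -- The correction is the Baker–Campbell–Hausdorff term r²C/2; no higher term survives. Constancy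
  -- of U between 0 and 1 gives C/2 = 0.
  let U : ℂ → A := fun r => NormedSpace.exp (r • (-(a + b))) * (NormedSpace.exp (r • a) *
    NormedSpace.exp (r • b)) - (r ^ 2 / 2) • C
  have hU : ∀ r, HasDerivAt U 0 r := by
    intro r
    have h1 := ((hasDerivAt_exp_smul_const (𝕂 := ℂ) (-(a + b)) r).mul
      ((hasDerivAt_exp_smul_const (𝕂 := ℂ) a r).mul
        (hasDerivAt_exp_smul_const' (𝕂 := ℂ) b r))).sub
      ((((hasDerivAt_id r).pow 2).div_const 2).smul_const C)
    refine h1.congr_deriv ?_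
    have h2 : NormedSpace.exp (r • a) * b - b * NormedSpace.exp (r • a) =
        (r * Complex.exp (r * s)) • C := by
      have := exp_commutator (a := r • a) (m := b) (C := r • C) (s := r * s) (t := r * s)
        (by rw [smul_mul_assoc, mul_smul_comm, ← smul_sub, hC])
        (by rw [smul_mul_smul_comm, hal, smul_smul, smul_smul]; ring_nf)
        (by rw [smul_mul_smul_comm, har, smul_smul, smul_smul]; ring_nf)
      rw [this, sub_self, expSlope_zero, smul_smul]
      ring_nf
    have h3 : C * NormedSpace.exp (r • b) = Complex.exp (r * t) • C :=
      mul_exp_of_mul_eq_smul (by rw [mul_smul_comm, hbr, smul_smul])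
    have h4 : NormedSpace.exp (r • (-(a + b))) * C = Complex.exp (-(r * (s + t))) • C :=
      exp_mul_of_mul_eq_smul (by
        rw [smul_mul_assoc, neg_mul, add_mul, hal, hbl, ← add_smul, ← neg_smul, smul_smul]
        ring_nf)
    have h5 : a * NormedSpace.exp (r • a) = NormedSpace.exp (r • a) * a :=
      (((Commute.refl a).smul_right r).exp_right).eq
    calc _ = NormedSpace.exp (r • (-(a + b))) * ((NormedSpace.exp (r • a) * b -
            b * NormedSpace.exp (r • a)) * NormedSpace.exp (r • b)) - r • C +
            NormedSpace.exp (r • (-(a + b))) * ((NormedSpace.exp (r • a) * a -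
            a * NormedSpace.exp (r • a)) * NormedSpace.exp (r • b)) := by
          simp only [id_eq, Pi.mul_apply]
          have : ((2 : ℕ) * r ^ (2 - 1) * 1 / 2 : ℂ) = r := by norm_num
          rw [this]
          noncomm_ring
      _ = 0 := by
          rw [h2, h5, smul_mul_assoc, h3, mul_smul_comm, mul_smul_comm, h4, smul_smul, smul_smul,
            sub_self, zero_mul, mul_zero, add_zero, ← sub_smul, mul_assoc r, mul_assoc r,
            ← Complex.exp_add, ← Complex.exp_add]
          ring_nf
          simp
  have hconst := is_const_of_deriv_eq_zero (fun t => (hU t).differentiableAt)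
    (fun t => (hU t).deriv) 1 0
  simp only [U, one_smul, zero_smul, NormedSpace.exp_zero, one_mul, ← h, exp_neg_mul_exp] at hconst
  simpa using hconst

/-- The commutator of `a` and `b` vanishes if `e ^ (a + b) = e ^ a * e ^ b` and the commutator is
an eigenvector of left and right multiplication by `a` and by `b`, with eigenvalues in suitable
strips. -/
theorem commutator_eq_zero_of_exp_add {a b C : A} {a₁ a₂ b₁ b₂ : ℂ} (hC : a * b - b * a = C)
    (hal : a * C = a₁ • C) (har : C * a = a₂ • C) (hbl : b * C = b₁ • C) (hbr : C * b = b₂ • C)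
    (ha : |(a₁ - a₂).im| < 2 * Real.pi) (hb : |(b₁ - b₂).im| < 2 * Real.pi)
    (hab : |(a₁ - a₂ + (b₁ - b₂)).im| < 2 * Real.pi)
    (h : NormedSpace.exp (a + b) = NormedSpace.exp a * NormedSpace.exp b) : C = 0 := by
  by_contra hC0
  have hxa : Commute (a + b) (NormedSpace.exp a * NormedSpace.exp b) := by
    rw [← h]; exact (Commute.refl _).exp_right
  have h1 : expSlope (b₁ - b₂) = expSlope (-(a₁ - a₂)) := by
    have ea := exp_commutator hC hal har
    have eb := exp_commutator (a := b) (m := a) (C := -C) (s := b₁) (t := b₂)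
      (by rw [← hC]; abel) (by rw [mul_neg, hbl, smul_neg]) (by rw [neg_mul, hbr, smul_neg])
    have hca : Commute a (NormedSpace.exp a) := (Commute.refl a).exp_right
    have hcb : Commute b (NormedSpace.exp b) := (Commute.refl b).exp_right
    -- This is [e^a e^b, a + b] = 0 expanded by the Leibniz rule, with [e^a, a] = [e^b, b] = 0.
    have key : (NormedSpace.exp a * b - b * NormedSpace.exp a) * NormedSpace.exp b +
        NormedSpace.exp a * (NormedSpace.exp b * a - a * NormedSpace.exp b) = 0 := by
      have e := hxa.eq
      rw [← sub_eq_zero] at e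
      calc _ = -((a + b) * (NormedSpace.exp a * NormedSpace.exp b) -
            NormedSpace.exp a * NormedSpace.exp b * (a + b)) +
            (a * NormedSpace.exp a - NormedSpace.exp a * a) * NormedSpace.exp b +
            NormedSpace.exp a * (b * NormedSpace.exp b - NormedSpace.exp b * b) := by noncomm_ring
        _ = 0 := by rw [e, hca.eq, hcb.eq]; simp
    rw [ea, eb, smul_mul_assoc, mul_exp_of_mul_eq_smul hbr, smul_neg, mul_neg, mul_smul_comm,
      exp_mul_of_mul_eq_smul hal, smul_smul, smul_smul, ← sub_eq_add_neg, ← sub_smul,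
      smul_eq_zero, or_iff_left hC0] at key
    rw [expSlope_neg]
    have h2 := Complex.exp_ne_zero b₂
    have h3 := Complex.exp_ne_zero a₁
    have h4 : Complex.exp (-(a₁ - a₂)) * Complex.exp a₁ = Complex.exp a₂ := by
      rw [← Complex.exp_add]; ring_nf
    apply mul_left_cancel₀ (mul_ne_zero h2 h3)
    linear_combination -key - Complex.exp b₂ * expSlope (a₁ - a₂) * h4
  have hγ : a₁ - a₂ + (b₁ - b₂) = 0 := by
    have := expSlope_injective hb (by rwa [Complex.neg_im, abs_neg])
      (by
        have e : (b₁ - b₂).im - (-(a₁ - a₂)).im = (a₁ - a₂ + (b₁ - b₂)).im := by simp; ring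
        rwa [e]) h1
    linear_combination this
  -- The same relation for the pair (a + b, -b), whose exponentials multiply to e^a.
  have h2 : expSlope (-(a₁ - a₂ + (b₁ - b₂))) = expSlope (-(b₁ - b₂)) := by
    have ec := exp_commutator (a := a + b) (m := a) (C := -C) (s := a₁ + b₁) (t := a₂ + b₂)
      (by rw [← hC]; noncomm_ring) (by rw [mul_neg, add_mul, hal, hbl, smul_neg, add_smul])
      (by rw [neg_mul, mul_add, har, hbr, smul_neg, add_smul])
    have hbl' : -b * C = (-b₁) • C := by rw [neg_mul, hbl, neg_smul]
    have hbr' : C * -b = (-b₂) • C := by rw [mul_neg, hbr, neg_smul]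
    have eb := exp_commutator (a := -b) (m := a) (C := C) (s := -b₁) (t := -b₂)
      (by rw [← hC]; noncomm_ring) hbl' hbr'
    have hE : NormedSpace.exp (a + b) * NormedSpace.exp (-b) = NormedSpace.exp a := by
      rw [h, mul_assoc, exp_mul_exp_neg, mul_one]
    have hca : Commute a (NormedSpace.exp (a + b) * NormedSpace.exp (-b)) := by
      rw [hE]; exact (Commute.refl a).exp_right
    have key : (NormedSpace.exp (a + b) * a - a * NormedSpace.exp (a + b)) * NormedSpace.exp (-b) +
        NormedSpace.exp (a + b) * (NormedSpace.exp (-b) * a - a * NormedSpace.exp (-b)) = 0 := by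
      have e := hca.eq
      rw [← sub_eq_zero] at e
      calc _ = -(a * (NormedSpace.exp (a + b) * NormedSpace.exp (-b)) -
            NormedSpace.exp (a + b) * NormedSpace.exp (-b) * a) := by noncomm_ring
        _ = 0 := by rw [e, neg_zero]
    have hcl : (a + b) * C = (a₁ + b₁) • C := by rw [add_mul, hal, hbl, add_smul]
    rw [ec, eb, smul_neg, neg_mul, smul_mul_assoc, mul_exp_of_mul_eq_smul hbr', mul_smul_comm,
      exp_mul_of_mul_eq_smul hcl, smul_smul, smul_smul, neg_add_eq_sub, ← sub_smul,
      smul_eq_zero, or_iff_left hC0] at key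
    rw [expSlope_neg (a₁ - a₂ + (b₁ - b₂))]
    have h2 := Complex.exp_ne_zero (-b₂)
    have h3 := Complex.exp_ne_zero (a₁ + b₁)
    have h4 : Complex.exp (-(a₁ - a₂ + (b₁ - b₂))) * Complex.exp (a₁ + b₁) =
        Complex.exp (a₂ + b₂) := by
      rw [← Complex.exp_add]; ring_nf
    have e1 : -b₁ - -b₂ = -(b₁ - b₂) := by ring
    have e2 : a₁ + b₁ - (a₂ + b₂) = a₁ - a₂ + (b₁ - b₂) := by ring
    rw [e1, e2] at key
    apply mul_left_cancel₀ (mul_ne_zero h2 h3)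
    linear_combination -key + Complex.exp (-b₂) * expSlope (a₁ - a₂ + (b₁ - b₂)) * h4
  have hα : a₁ - a₂ = 0 := by
    have := expSlope_injective (p := -(a₁ - a₂ + (b₁ - b₂))) (q := -(b₁ - b₂))
      (by rwa [Complex.neg_im, abs_neg]) (by rwa [Complex.neg_im, abs_neg])
      (by
        have e : (-(a₁ - a₂ + (b₁ - b₂))).im - (-(b₁ - b₂)).im = -(a₁ - a₂).im := by simp
        rwa [e, abs_neg]) h2
    linear_combination -this
  have hβ : b₁ - b₂ = 0 := by linear_combination hγ - hα
  rw [← sub_eq_zero.1 hα] at har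
  rw [← sub_eq_zero.1 hβ] at hbr
  exact hC0 (commutator_eq_zero_of_central hC hal har hbl hbr h)

end BanachAlgebra

/-! ### Exponential and logarithm as integrals -/

/-- The integrand of `segmentLog`. -/
noncomputable def segmentLogIntegrand {A : Type*} [Ring A] [Algebra ℂ A] (x : A) (t : ℝ) :
    A :=
  (x - 1) * Ring.inverse (1 + (t : ℂ) • (x - 1))

theorem Commute.segmentLogIntegrand_right {A : Type*} [Ring A] [Algebra ℂ A] {x m : A}
    (h : Commute m x) {t : ℝ} (hu : IsUnit (1 + (t : ℂ) • (x - 1))) :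
    Commute m (segmentLogIntegrand x t) := by
  have h1 : Commute m (x - 1) := h.sub_right (Commute.one_right m)
  obtain ⟨u, hu⟩ := hu
  have h2 : Commute m (u : A) := by
    rw [hu]; exact (Commute.one_right m).add_right (h1.smul_right (t : ℂ))
  rw [segmentLogIntegrand, ← hu, Ring.inverse_unit]
  exact h1.mul_right h2.units_inv_right

section BanachAlgebra

variable {A E : Type*} [NormedRing A] [NormedAlgebra ℂ A] [CompleteSpace A]
  [NormedAddCommGroup E] [NormedSpace ℂ E]

theorem LinearMap.map_exp_of_map_pow [FiniteDimensional ℂ A] (φ : A →ₗ[ℂ] E) {a : A} {s : ℂ}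
    (h : ∀ k : ℕ, φ (a ^ k) = s ^ k • φ 1) : φ (NormedSpace.exp a) = Complex.exp s • φ 1 :=
  (LinearMap.toContinuousLinearMap φ).map_exp_of_map_pow h

/-- The integral `∫₀¹ e ^ (t a) dt`. -/
noncomputable def expIntegral (a : A) : A := ∫ t in (0 : ℝ)..1, NormedSpace.exp ((t : ℂ) • a)

theorem hasDerivAt_exp_ofReal_smul (a : A) (t : ℝ) :
    HasDerivAt (fun t : ℝ => NormedSpace.exp ((t : ℂ) • a))
      (a * NormedSpace.exp ((t : ℂ) • a)) t := by
  have h := (hasDerivAt_exp_smul_const' (𝕂 := ℂ) a (t : ℂ)).scomp t Complex.ofRealCLM.hasDerivAt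
  simpa [Function.comp_def] using h

theorem continuous_exp_ofReal_smul (a : A) :
    Continuous (fun t : ℝ => NormedSpace.exp ((t : ℂ) • a)) :=
  continuous_iff_continuousAt.2 fun t => (hasDerivAt_exp_ofReal_smul a t).continuousAt

theorem LinearMap.map_expIntegral [FiniteDimensional ℂ A] [CompleteSpace E] (φ : A →ₗ[ℂ] E)
    (a : A) :
    φ (expIntegral a) = ∫ t in (0 : ℝ)..1, φ (NormedSpace.exp ((t : ℂ) • a)) :=
  ((LinearMap.toContinuousLinearMap φ).intervalIntegral_comp_comm
    ((continuous_exp_ofReal_smul a).intervalIntegrable 0 1)).symm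

theorem mul_expIntegral [FiniteDimensional ℂ A] (a : A) :
    a * expIntegral a = NormedSpace.exp a - 1 := by
  have h := (LinearMap.mulLeft ℂ a).map_expIntegral a
  simp only [LinearMap.mulLeft_apply] at h
  rw [h, intervalIntegral.integral_eq_sub_of_hasDerivAt
    (fun t _ => hasDerivAt_exp_ofReal_smul a t)
    ((continuous_const.mul (continuous_exp_ofReal_smul a)).intervalIntegrable 0 1)]
  simp

theorem commute_expIntegral [FiniteDimensional ℂ A] (a : A) : Commute (expIntegral a) a := by
  have h1 := (LinearMap.mulLeft ℂ a).map_expIntegral a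
  have h2 := (LinearMap.mulRight ℂ a).map_expIntegral a
  simp only [LinearMap.mulLeft_apply, LinearMap.mulRight_apply] at h1 h2
  rw [commute_iff_eq, h1, h2]
  congr 1
  ext1 t
  exact ((((Commute.refl a).smul_right (t : ℂ)).exp_right).eq).symm

/-- The integral `∫₀ˢ (x - 1) (1 + t (x - 1))⁻¹ dt`, a logarithm of `1 + s (x - 1)`. -/
noncomputable def segmentLog (x : A) (s : ℝ) : A :=
  ∫ t in (0 : ℝ)..s, segmentLogIntegrand x t

theorem continuousAt_segmentLogIntegrand {x : A} {t : ℝ}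
    (h : IsUnit (1 + (t : ℂ) • (x - 1))) : ContinuousAt (segmentLogIntegrand x) t := by
  obtain ⟨u, hu⟩ := h
  have h1 := NormedRing.inverse_continuousAt u
  rw [hu] at h1
  have h2 : ContinuousAt (fun t : ℝ => 1 + (t : ℂ) • (x - 1)) t := by fun_prop
  exact continuousAt_const.mul (ContinuousAt.comp (f := fun t : ℝ => 1 + (t : ℂ) • (x - 1)) h1 h2)

theorem intervalIntegrable_segmentLogIntegrand {x : A}
    (hx : ∀ t ∈ Set.Icc (0 : ℝ) 1, IsUnit (1 + (t : ℂ) • (x - 1))) {s : ℝ}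
    (hs : s ∈ Set.Icc (0 : ℝ) 1) :
    IntervalIntegrable (segmentLogIntegrand x) MeasureTheory.volume 0 s := by
  apply ContinuousOn.intervalIntegrable
  rw [Set.uIcc_of_le hs.1]
  exact fun t ht => (continuousAt_segmentLogIntegrand
    (hx t ⟨ht.1, ht.2.trans hs.2⟩)).continuousWithinAt

theorem LinearMap.map_segmentLog [FiniteDimensional ℂ A] [CompleteSpace E] (φ : A →ₗ[ℂ] E)
    {x : A}
    (hx : ∀ t ∈ Set.Icc (0 : ℝ) 1, IsUnit (1 + (t : ℂ) • (x - 1))) {s : ℝ}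
    (hs : s ∈ Set.Icc (0 : ℝ) 1) :
    φ (segmentLog x s) = ∫ t in (0 : ℝ)..s, φ (segmentLogIntegrand x t) :=
  ((LinearMap.toContinuousLinearMap φ).intervalIntegral_comp_comm
    (intervalIntegrable_segmentLogIntegrand hx hs)).symm

theorem hasDerivAt_segmentLog {x : A}
    (hx : ∀ t ∈ Set.Icc (0 : ℝ) 1, IsUnit (1 + (t : ℂ) • (x - 1))) {s : ℝ}
    (hs : s ∈ Set.Icc (0 : ℝ) 1) :
    HasDerivAt (segmentLog x) (segmentLogIntegrand x s) s := by
  have hopen : IsOpen {t : ℝ | IsUnit (1 + (t : ℂ) • (x - 1))} :=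
    Units.isOpen.preimage (by fun_prop : Continuous fun t : ℝ => 1 + (t : ℂ) • (x - 1))
  exact intervalIntegral.integral_hasDerivAt_right (intervalIntegrable_segmentLogIntegrand hx hs)
    (ContinuousAt.stronglyMeasurableAtFilter hopen (fun t ht => continuousAt_segmentLogIntegrand ht)
      s (hx s hs))
    (continuousAt_segmentLogIntegrand (hx s hs))

theorem Commute.segmentLog_right [FiniteDimensional ℂ A] {x m : A} (h : Commute m x)
    (hx : ∀ t ∈ Set.Icc (0 : ℝ) 1, IsUnit (1 + (t : ℂ) • (x - 1))) {s : ℝ}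
    (hs : s ∈ Set.Icc (0 : ℝ) 1) : Commute m (segmentLog x s) := by
  have e1 := (LinearMap.mulLeft ℂ m).map_segmentLog hx hs
  have e2 := (LinearMap.mulRight ℂ m).map_segmentLog hx hs
  simp only [LinearMap.mulLeft_apply, LinearMap.mulRight_apply] at e1 e2
  rw [commute_iff_eq, e1, e2]
  apply intervalIntegral.integral_congr
  intro t ht
  rw [Set.uIcc_of_le hs.1] at ht
  exact (h.segmentLogIntegrand_right (hx t ⟨ht.1, ht.2.trans hs.2⟩)).eq

/-- The derivative of the exponential along a path commuting with its base point. -/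
theorem HasDerivAt.exp_of_commute {f : ℝ → A} {f' : A} {s : ℝ} (hf : HasDerivAt f f' s)
    {S : Set ℝ} (hc : ∀ t ∈ S, Commute (f s) (f t)) :
    HasDerivWithinAt (fun t => NormedSpace.exp (f t)) (NormedSpace.exp (f s) * f') S s := by
  have h1 : HasDerivAt (fun t => f t - f s) f' s := hf.sub_const _
  have h0 : HasFDerivAt (NormedSpace.exp : A → A) (1 : A →L[ℝ] A) (f s - f s) := by
    rw [sub_self]; exact hasFDerivAt_exp_zero
  have h2 : HasDerivAt (fun t => NormedSpace.exp (f t - f s)) f' s := by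
    have h := h0.comp_hasDerivAt s h1
    simpa [Function.comp_def] using h
  have h3 := (h2.const_mul (NormedSpace.exp (f s))).hasDerivWithinAt (s := S)
  -- By commutation e^(f s) factors out, so only the derivative of exp at 0 is needed.
  have h4 : ∀ t, Commute (f s) (f t) →
      NormedSpace.exp (f t) = NormedSpace.exp (f s) * NormedSpace.exp (f t - f s) := by
    intro t ht
    let _ := NormedAlgebra.restrictScalars ℚ ℂ A
    rw [← NormedSpace.exp_add_of_commute (ht.sub_right (Commute.refl _)), add_sub_cancel]
  exact h3.congr (fun t ht => h4 t (hc t ht)) (h4 s (Commute.refl _))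

theorem exp_segmentLog [FiniteDimensional ℂ A] {x : A}
    (hx : ∀ t ∈ Set.Icc (0 : ℝ) 1, IsUnit (1 + (t : ℂ) • (x - 1))) :
    NormedSpace.exp (segmentLog x 1) = x := by
  have hcomm : ∀ s ∈ Set.Icc (0 : ℝ) 1, ∀ t ∈ Set.Icc (0 : ℝ) 1,
      Commute (-segmentLog x s) (-segmentLog x t) := by
    intro s hs t ht
    exact ((((Commute.refl x).segmentLog_right hx hs).symm.segmentLog_right hx
      ht).neg_left).neg_right
  -- With L(s) the logarithm along the segment, e^(-L(s)) (1 + s(x - 1)) is constant, equal to 1.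
  let G : ℝ → A := fun s => NormedSpace.exp (-segmentLog x s) * (1 + (s : ℂ) • (x - 1))
  have hG : ∀ s ∈ Set.Icc (0 : ℝ) 1, HasDerivWithinAt G 0 (Set.Icc 0 1) s := by
    intro s hs
    have h1 := (hasDerivAt_segmentLog hx hs).neg.exp_of_commute (S := Set.Icc 0 1) (hcomm s hs)
    have h2 : HasDerivAt (fun s : ℝ => 1 + (s : ℂ) • (x - 1)) (x - 1) s :=
      (((Complex.ofRealCLM.hasDerivAt (x := s)).smul_const (x - 1)).const_add 1).congr_deriv
        (by simp)
    refine (h1.mul h2.hasDerivWithinAt).congr_deriv ?_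
    have h3 : segmentLogIntegrand x s * (1 + (s : ℂ) • (x - 1)) = x - 1 := by
      rw [segmentLogIntegrand, mul_assoc, Ring.inverse_mul_cancel _ (hx s hs), mul_one]
    rw [mul_assoc, neg_mul, h3, mul_neg, Pi.neg_apply, neg_add_cancel]
  have hconst := constant_of_has_deriv_right_zero (f := G) (a := 0) (b := 1)
    (fun s hs => (hG s hs).continuousWithinAt)
    (fun s hs => (hG s ⟨hs.1, hs.2.le⟩).mono_of_mem_nhdsWithin
      (Filter.mem_of_superset (Icc_mem_nhdsGE hs.2) (Set.Icc_subset_Icc_left hs.1)))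
    1 (Set.right_mem_Icc.2 zero_le_one)
  have h0 : G 0 = 1 := by simp [G, segmentLog]
  rw [h0] at hconst
  simp only [G, Complex.ofReal_one, one_smul, add_sub_cancel] at hconst
  calc _ = NormedSpace.exp (segmentLog x 1) * (NormedSpace.exp (-segmentLog x 1) * x) := by
        rw [hconst, mul_one]
    _ = x := by rw [← mul_assoc, exp_mul_exp_neg, one_mul]

end BanachAlgebra

/-! ### Existence, uniqueness and triangularity of the principal logarithm -/

section PrincipalLog

open scoped Matrix.Norms.Operator

variable {n : ℕ}

/-- Commuting complex matrices have a common eigenvector for any eigenvalue of the first one. -/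
theorem Commute.exists_common_eigenvector {x y : Matrix (Fin n) (Fin n) ℂ} (h : Commute x y)
    {z : ℂ} (hz : z ∈ spectrum ℂ x) :
    ∃ v : Fin n → ℂ, v ≠ 0 ∧ x.mulVec v = z • v ∧ ∃ w : ℂ, y.mulVec v = w • v := by
  rw [← Matrix.spectrum_toLin', ← Module.End.hasEigenvalue_iff_mem_spectrum] at hz
  have hc : Commute (Matrix.toLin' x) (Matrix.toLin' y) := by
    rw [commute_iff_eq, Module.End.mul_eq_comp, Module.End.mul_eq_comp, ← Matrix.toLin'_mul,
      ← Matrix.toLin'_mul, h.eq]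
  have hmap : Set.MapsTo (Matrix.toLin' y) (Module.End.eigenspace (Matrix.toLin' x) z)
      (Module.End.eigenspace (Matrix.toLin' x) z) :=
    Module.End.mapsTo_genEigenspace_of_comm hc z 1
  have : Nontrivial (Module.End.eigenspace (Matrix.toLin' x) z) :=
    Submodule.nontrivial_iff_ne_bot.2 hz
  obtain ⟨w, hw⟩ := Module.End.exists_eigenvalue ((Matrix.toLin' y).restrict hmap)
  obtain ⟨v, hv⟩ := hw.exists_hasEigenvector
  refine ⟨v, fun h0 => hv.2 (Subtype.ext h0), ?_, w, ?_⟩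
  · simpa using Module.End.mem_eigenspace_iff.1 v.2
  · exact congrArg Subtype.val hv.apply_eq_smul

theorem Matrix.mem_spectrum_of_mulVec_eq_smul {x : Matrix (Fin n) (Fin n) ℂ} {v : Fin n → ℂ}
    {w : ℂ} (hv : v ≠ 0) (h : x.mulVec v = w • v) : w ∈ spectrum ℂ x := by
  rw [← Matrix.spectrum_toLin', ← Module.End.hasEigenvalue_iff_mem_spectrum]
  exact Module.End.hasEigenvalue_of_hasEigenvector
    ⟨Module.End.mem_eigenspace_iff.2 (by simpa using h), hv⟩

theorem Matrix.exp_mulVec_of_mulVec_eq_smul {x : Matrix (Fin n) (Fin n) ℂ} {v : Fin n → ℂ} {w : ℂ}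
    (h : x.mulVec v = w • v) : (NormedSpace.exp x).mulVec v = Complex.exp w • v := by
  have := ((Matrix.mulVecBilin ℂ ℂ).flip v).map_exp_of_map_pow (a := x) (s := w) (by
    intro k
    induction k with
    | zero => simp
    | succ k ih =>
      simp only [LinearMap.flip_apply, Matrix.mulVecBilin_apply, Matrix.one_mulVec] at ih ⊢
      rw [pow_succ, ← Matrix.mulVec_mulVec, h, Matrix.mulVec_smul, ih, smul_smul, pow_succ'])
  simp only [LinearMap.flip_apply, Matrix.mulVecBilin_apply, Matrix.one_mulVec] at this
  exact this

theorem Matrix.exp_mul_exp_neg (a : Matrix (Fin n) (Fin n) ℂ) :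
    NormedSpace.exp a * NormedSpace.exp (-a) = 1 :=
  _root_.exp_mul_exp_neg a

theorem Complex.eq_zero_of_exp_eq_one {z : ℂ} (h : Complex.exp z = 1)
    (hz : |z.im| < 2 * Real.pi) : z = 0 := by
  by_contra h0
  apply expSlope_ne_zero hz
  rw [expSlope_of_ne_zero h0, h, sub_self, zero_div]

/-- A matrix `N` with `e ^ N = 1` whose eigenvalues have imaginary part in `]-2π, 2π[` is zero. -/
theorem Matrix.eq_zero_of_exp_eq_one {N : Matrix (Fin n) (Fin n) ℂ} (h : NormedSpace.exp N = 1)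
    (hN : ∀ z ∈ spectrum ℂ N, |z.im| < 2 * Real.pi) : N = 0 := by
  have hzero : N * expIntegral N = 0 := (mul_expIntegral N).trans (sub_eq_zero.2 h)
  -- `expIntegral N` is ψ(N). A kernel vector can be taken to be an eigenvector of N; its eigenvalue
  -- μ satisfies e^μ = 1, so μ = 0, and ψ(N) then fixes the vector.
  have hunit : IsUnit (expIntegral N) := by
    by_contra hnu
    obtain ⟨v, hv, h1, μ, h2⟩ := (commute_expIntegral N).exists_common_eigenvector
      ((spectrum.zero_mem_iff ℂ).2 hnu)
    have hμ : μ = 0 := by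
      refine Complex.eq_zero_of_exp_eq_one ?_ (hN μ (Matrix.mem_spectrum_of_mulVec_eq_smul hv h2))
      have h3 := Matrix.exp_mulVec_of_mulVec_eq_smul h2
      rw [h, Matrix.one_mulVec] at h3
      exact (smul_left_injective ℂ hv (by simpa using h3)).symm
    have h4 : ∀ t : ℝ, (NormedSpace.exp ((t : ℂ) • N)).mulVec v = v := by
      intro t
      have := Matrix.exp_mulVec_of_mulVec_eq_smul (x := (t : ℂ) • N) (v := v) (w := 0)
        (by rw [Matrix.smul_mulVec, h2, hμ]; simp)
      simpa using this
    have h5 : (expIntegral N).mulVec v =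
        ∫ t in (0 : ℝ)..1, (NormedSpace.exp ((t : ℂ) • N)).mulVec v :=
      ((Matrix.mulVecBilin ℂ ℂ).flip v).map_expIntegral N
    simp only [h4, h1, zero_smul] at h5
    exact hv (by simpa using h5.symm)
  exact (hunit.mul_left_eq_zero).1 hzero

/-- A principal logarithm is determined by the matrix, once one is known to commute with the
other. -/
theorem IsPrincipalLog.eq_of_commute {x a b : Matrix (Fin n) (Fin n) ℂ} (ha : IsPrincipalLog x a)
    (hb : IsPrincipalLog x b) (h : Commute a b) : a = b := by
  rw [← sub_eq_zero]
  apply Matrix.eq_zero_of_exp_eq_one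
  · rw [sub_eq_add_neg, Matrix.exp_add_of_commute a (-b) h.neg_right, ha.1, ← hb.1,
      Matrix.exp_mul_exp_neg]
  · intro z hz
    -- On a common eigenvector of a - b and a, z is a difference of eigenvalues of a and b, so |Im
    -- z| < 2π.
    have hc : Commute (a - b) a := (Commute.refl a).sub_left h.symm
    obtain ⟨v, hv, h1, w, h2⟩ := hc.exists_common_eigenvector hz
    have h3 : b.mulVec v = (w - z) • v := by
      rw [Matrix.sub_mulVec, h2] at h1
      rw [sub_smul, ← h1, sub_sub_cancel]
    have h4 := ha.2 w (Matrix.mem_spectrum_of_mulVec_eq_smul hv h2)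
    have h5 := hb.2 (w - z) (Matrix.mem_spectrum_of_mulVec_eq_smul hv h3)
    rw [Complex.sub_im] at h5
    rw [abs_lt]
    constructor <;> linarith

theorem NoNonposEigenvalue.isUnit_segment {x : Matrix (Fin n) (Fin n) ℂ}
    (hx : NoNonposEigenvalue x) : ∀ t ∈ Set.Icc (0 : ℝ) 1, IsUnit (1 + (t : ℂ) • (x - 1)) := by
  intro t ht
  rcases ht.1.eq_or_lt with h0 | h0
  · simp [← h0]
  · have h1 := hx (1 - t⁻¹) (by linarith [(one_le_inv₀ h0).2 ht.2])
    rw [spectrum.notMem_iff, Algebra.algebraMap_eq_smul_one] at h1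
    have ht0 : (t : ℂ) ≠ 0 := by exact_mod_cast h0.ne'
    -- Invertibility holds because 1 - t⁻¹ ≤ 0 is not an eigenvalue of x.
    have h2 : 1 + (t : ℂ) • (x - 1) = (-(t : ℂ)) • (((1 - t⁻¹ : ℝ) : ℂ) •
        (1 : Matrix (Fin n) (Fin n) ℂ) - x) := by
      have e : -(t : ℂ) * ((1 - t⁻¹ : ℝ) : ℂ) = 1 - t := by push_cast; field_simp; ring
      rw [smul_sub (-(t : ℂ)), smul_smul, e, smul_sub, sub_smul, one_smul, neg_smul]
      abel
    rw [h2]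
    exact h1.smul (Units.mk0 (-(t : ℂ)) (neg_ne_zero.2 ht0))

/-- An eigenvector of the integral can be chosen to be an eigenvector of x too, with eigenvalue w.
The integral then acts on it as the scalar Log w, whose imaginary part is arg w. -/
theorem isPrincipalLog_segmentLog {x : Matrix (Fin n) (Fin n) ℂ} (hx : NoNonposEigenvalue x) :
    IsPrincipalLog x (segmentLog x 1) := by
  refine ⟨exp_segmentLog hx.isUnit_segment, fun z hz => ?_⟩
  have h1 : (1 : ℝ) ∈ Set.Icc (0 : ℝ) 1 := Set.right_mem_Icc.2 zero_le_one
  obtain ⟨v, hv, hz, w, hw⟩ :=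
    ((Commute.refl x).segmentLog_right hx.isUnit_segment h1).symm.exists_common_eigenvector hz
  have hslit : w ∈ Complex.slitPlane := by
    rw [Complex.mem_slitPlane_iff_not_le_zero]
    intro hle
    have hre : ((w.re : ℝ) : ℂ) = w := Complex.ext (by simp) (by simpa using (hle.2).symm)
    refine hx w.re (by simpa using hle.1) ?_
    rw [hre]
    exact Matrix.mem_spectrum_of_mulVec_eq_smul hv hw
  have hw1 : (x - 1).mulVec v = (w - 1) • v := by
    rw [Matrix.sub_mulVec, hw, Matrix.one_mulVec, sub_smul, one_smul]
  have hint : ∀ t ∈ Set.uIcc (0 : ℝ) 1, (segmentLogIntegrand x t).mulVec v =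
      ((w - 1) * (1 + (t : ℂ) • (w - 1))⁻¹) • v := by
    intro t ht
    rw [Set.uIcc_of_le zero_le_one] at ht
    have hne : 1 + (t : ℂ) • (w - 1) ≠ 0 := Complex.slitPlane_ne_zero
      (Complex.starConvex_one_slitPlane.add_smul_sub_mem hslit ht.1 ht.2)
    have hu := hx.isUnit_segment t ht
    have e1 : (1 + (t : ℂ) • (x - 1)).mulVec v = (1 + (t : ℂ) • (w - 1)) • v := by
      rw [Matrix.add_mulVec, Matrix.one_mulVec, Matrix.smul_mulVec, hw1, add_smul, one_smul,
        smul_assoc]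
    have e2 : (Ring.inverse (1 + (t : ℂ) • (x - 1))).mulVec v = (1 + (t : ℂ) • (w - 1))⁻¹ • v := by
      have := congrArg (fun y => (1 + (t : ℂ) • (w - 1))⁻¹ •
        (Ring.inverse (1 + (t : ℂ) • (x - 1))).mulVec y) e1
      simp only [Matrix.mulVec_mulVec, Ring.inverse_mul_cancel _ hu, Matrix.one_mulVec,
        Matrix.mulVec_smul, smul_smul, inv_mul_cancel₀ hne, one_smul] at this
      exact this.symm
    rw [segmentLogIntegrand, ← Matrix.mulVec_mulVec, e2, Matrix.mulVec_smul, hw1, smul_smul,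
      mul_comm]
  have h2 : (segmentLog x 1).mulVec v =
      ∫ t in (0 : ℝ)..1, (segmentLogIntegrand x t).mulVec v :=
    ((Matrix.mulVecBilin ℂ ℂ).flip v).map_segmentLog hx.isUnit_segment h1
  rw [intervalIntegral.integral_congr hint, intervalIntegral.integral_smul_const,
    intervalIntegral.integral_const_mul, hz] at h2
  have hlog := Complex.log_eq_integral (z := w - 1) (by simpa using hslit)
  simp only [Complex.real_smul, smul_eq_mul, add_sub_cancel] at hlog h2
  have h3 : z = Complex.log w := (smul_left_injective ℂ hv h2).trans hlog.symm
  rw [h3, Complex.log_im]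
  exact ⟨Complex.neg_pi_lt_arg w,
    lt_of_le_of_ne (Complex.arg_le_pi w) (Complex.mem_slitPlane_iff_arg.1 hslit).1⟩

/-- Any principal logarithm a commutes with x = e^a, hence with the integral built from x, so
uniqueness for commuting logarithms applies. -/
theorem IsPrincipalLog.eq_segmentLog {x a : Matrix (Fin n) (Fin n) ℂ} (hx : NoNonposEigenvalue x)
    (ha : IsPrincipalLog x a) : a = segmentLog x 1 := by
  have h1 : (1 : ℝ) ∈ Set.Icc (0 : ℝ) 1 := Set.right_mem_Icc.2 zero_le_one
  refine ha.eq_of_commute (isPrincipalLog_segmentLog hx) ?_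
  have hax : Commute a x := by rw [← ha.1]; exact (Commute.refl a).exp_right
  exact hax.segmentLog_right hx.isUnit_segment h1

theorem isPrincipalLog_principalLog {x : Matrix (Fin n) (Fin n) ℂ} (hx : NoNonposEigenvalue x) :
    IsPrincipalLog x (principalLog x) := by
  have h : ∃ a, IsPrincipalLog x a := ⟨_, isPrincipalLog_segmentLog hx⟩
  rw [principalLog, dif_pos h]
  exact h.choose_spec

/-- Inverses of upper triangular matrices are upper triangular, so the entries of the integrand
below the diagonal vanish. -/
theorem IsPrincipalLog.blockTriangular {x a : Matrix (Fin n) (Fin n) ℂ}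
    (hx : NoNonposEigenvalue x) (ha : IsPrincipalLog x a) (ht : x.BlockTriangular id) :
    a.BlockTriangular id := by
  have h1 : (1 : ℝ) ∈ Set.Icc (0 : ℝ) 1 := Set.right_mem_Icc.2 zero_le_one
  rw [ha.eq_segmentLog hx]
  intro i j hij
  have h2 : segmentLog x 1 i j = ∫ t in (0 : ℝ)..1, segmentLogIntegrand x t i j :=
    (Matrix.entryLinearMap ℂ ℂ i j).map_segmentLog hx.isUnit_segment h1
  rw [h2, intervalIntegral.integral_congr (g := fun _ => 0), intervalIntegral.integral_zero]
  intro t hmem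
  rw [Set.uIcc_of_le zero_le_one] at hmem
  have hx1 : (x - 1).BlockTriangular id := ht.sub Matrix.blockTriangular_one
  have hb : (1 + (t : ℂ) • (x - 1)).BlockTriangular id :=
    Matrix.blockTriangular_one.add fun i j hij => by
      rw [Matrix.smul_apply, hx1 hij, smul_zero]
  have := (hx.isUnit_segment t hmem).invertible
  have hb' := Matrix.blockTriangular_inv_of_blockTriangular hb
  rw [Matrix.nonsing_inv_eq_ringInverse] at hb'
  exact (hx1.mul hb') hij

end PrincipalLog

/-! ### Upper triangular matrices: induction on the size -/

theorem LinearMap.map_exp_eq_exp_map {A B : Type*} [NormedRing A] [NormedAlgebra ℂ A]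
    [CompleteSpace A] [FiniteDimensional ℂ A] [NormedRing B] [NormedAlgebra ℂ B] [CompleteSpace B]
    (φ : A →ₗ[ℂ] B) {a : A} (h : ∀ k : ℕ, φ (a ^ k) = φ a ^ k) :
    φ (NormedSpace.exp a) = NormedSpace.exp (φ a) := by
  have h1 := (NormedSpace.exp_series_hasSum_exp' (𝕂 := ℂ) a).mapL
    (LinearMap.toContinuousLinearMap φ)
  have h2 := NormedSpace.exp_series_hasSum_exp' (𝕂 := ℂ) (φ a)
  refine h1.unique (h2.congr_fun fun k => ?_)
  simp [h]

section Triangular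

open scoped Matrix.Norms.Operator

variable {m n : ℕ} {f : Fin m → Fin n} {a b : Matrix (Fin n) (Fin n) ℂ}

/-- In the (f i, f j) entry of the product only indices k with f i ≤ k ≤ f j contribute, and these
lie in the range of f because it is an interval. -/
theorem Matrix.BlockTriangular.submatrix_mul (hf : StrictMono f)
    (hr : (Set.range f).OrdConnected) (ha : a.BlockTriangular id) (hb : b.BlockTriangular id) :
    (a * b).submatrix f f = a.submatrix f f * b.submatrix f f := by
  ext i j
  simp only [Matrix.submatrix_apply, Matrix.mul_apply]
  refine (Fintype.sum_of_injective f hf.injective _ _ (fun k hk => ?_) fun _ => rfl).symm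
  by_cases h1 : k < f i
  · rw [ha h1, zero_mul]
  by_cases h2 : f j < k
  · rw [hb h2, mul_zero]
  exact absurd (hr.out ⟨i, rfl⟩ ⟨j, rfl⟩ ⟨not_lt.1 h1, not_lt.1 h2⟩) hk

theorem Matrix.BlockTriangular.submatrix_exp (hf : StrictMono f)
    (hr : (Set.range f).OrdConnected) (ha : a.BlockTriangular id) :
    (NormedSpace.exp a).submatrix f f = NormedSpace.exp (a.submatrix f f) := by
  let φ : Matrix (Fin n) (Fin n) ℂ →ₗ[ℂ] Matrix (Fin m) (Fin m) ℂ :=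
    { toFun := fun x => x.submatrix f f
      map_add' := fun _ _ => rfl
      map_smul' := fun _ _ => rfl }
  refine φ.map_exp_eq_exp_map fun k => ?_
  induction k with
  | zero => exact Matrix.submatrix_one f hf.injective
  | succ k ih =>
    rw [pow_succ, pow_succ, ← ih]
    exact Matrix.BlockTriangular.submatrix_mul hf hr (ha.pow k) ha

theorem Matrix.BlockTriangular.diag_mem_spectrum (ha : a.BlockTriangular id) (i : Fin n) :
    a i i ∈ spectrum ℂ a := by
  rw [spectrum.mem_iff, Matrix.isUnit_iff_isUnit_det, Matrix.det_of_isUpperTriangular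
    ((Matrix.blockTriangular_algebraMap (a i i)).sub ha), isUnit_iff_ne_zero, not_not]
  exact Finset.prod_eq_zero (Finset.mem_univ i) (by simp [Matrix.algebraMap_matrix_apply])

/-- Upper triangular matrices `a` and `b` with `e ^ (a + b) = e ^ a * e ^ b` commute, if the
eigenvalues of `a`, `b` and `a + b` have imaginary part in `]-π, π[`. -/
theorem Matrix.BlockTriangular.mul_comm_of_exp_add : ∀ (n : ℕ) (a b : Matrix (Fin n) (Fin n) ℂ),
    a.BlockTriangular id → b.BlockTriangular id → (∀ i, |(a i i).im| < Real.pi) →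
    (∀ i, |(b i i).im| < Real.pi) → (∀ i, |(a i i + b i i).im| < Real.pi) →
    NormedSpace.exp (a + b) = NormedSpace.exp a * NormedSpace.exp b → a * b = b * a
  | 0, _, _, _, _, _, _, _, _ => Subsingleton.elim _ _
  | 1, a, b, _, _, _, _, _, _ => by
    ext i j
    rw [Subsingleton.elim i 0, Subsingleton.elim j 0]
    simp [Matrix.mul_apply, mul_comm]
  | n + 2, a, b, ha, hb, ha', hb', hab', h => by
    -- Applied below with the last or the first index deleted: together these kill every entry of
    -- the commutator except the top right one.
    have ind : ∀ f : Fin (n + 1) → Fin (n + 2), StrictMono f → (Set.range f).OrdConnected →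
        ∀ i j, (a * b - b * a) (f i) (f j) = 0 := by
      intro f hf hr i j
      have hsub : ∀ {x : Matrix (Fin (n + 2)) (Fin (n + 2)) ℂ}, x.BlockTriangular id →
          (x.submatrix f f).BlockTriangular id := fun hx i j hij => hx (hf hij)
      have h1 := mul_comm_of_exp_add (n + 1) (a.submatrix f f) (b.submatrix f f) (hsub ha)
        (hsub hb) (fun i => ha' (f i)) (fun i => hb' (f i)) (fun i => hab' (f i)) (by
          have h2 : (NormedSpace.exp (a + b)).submatrix f f =
              (NormedSpace.exp a * NormedSpace.exp b).submatrix f f := by rw [h]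
          rw [(ha.add hb).submatrix_exp hf hr, ha.exp.submatrix_mul hf hr hb.exp,
            ha.submatrix_exp hf hr, hb.submatrix_exp hf hr] at h2
          exact h2)
      rw [← ha.submatrix_mul hf hr hb, ← hb.submatrix_mul hf hr ha] at h1
      exact sub_eq_zero.2 (congrFun (congrFun h1 i) j)
    have hcast := ind Fin.castSucc Fin.strictMono_castSucc
      ⟨by
        rintro _ - _ ⟨j, rfl⟩ k ⟨-, hk⟩
        exact Fin.exists_castSucc_eq.2 (hk.trans_lt (Fin.castSucc_lt_last j)).ne⟩
    have hsucc := ind Fin.succ Fin.strictMono_succ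
      ⟨by
        rintro _ ⟨i, rfl⟩ _ - k ⟨hk, -⟩
        exact Fin.exists_succ_eq.2 ((Fin.succ_pos i).trans_le hk).ne'⟩
    set C := a * b - b * a with hC
    have hCt : C.BlockTriangular id := (ha.mul hb).sub (hb.mul ha)
    have hrow : ∀ i j, i ≠ 0 → C i j = 0 := by
      intro i j hi
      obtain ⟨i, rfl⟩ := Fin.exists_succ_eq.2 hi
      rcases Fin.eq_zero_or_eq_succ j with rfl | ⟨j, rfl⟩
      · exact hCt (Fin.succ_pos i)
      · exact hsucc i j
    have hcol : ∀ i j, j ≠ Fin.last (n + 1) → C i j = 0 := by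
      intro i j hj
      obtain ⟨j, rfl⟩ := Fin.exists_castSucc_eq.2 hj
      rcases Fin.eq_castSucc_or_eq_last i with ⟨i, rfl⟩ | rfl
      · exact hcast i j
      · exact hCt (Fin.castSucc_lt_last j)
    have hleft : ∀ {x : Matrix (Fin (n + 2)) (Fin (n + 2)) ℂ}, x.BlockTriangular id →
        x * C = x 0 0 • C := by
      intro x hx
      ext i j
      rw [Matrix.mul_apply, Finset.sum_eq_single 0
        (fun k _ hk => by rw [hrow k j hk, mul_zero]) (by simp), Matrix.smul_apply, smul_eq_mul]
      by_cases hi : i = 0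
      · rw [hi]
      · rw [hx (Fin.pos_of_ne_zero hi), hrow i j hi, zero_mul, mul_zero]
    have hright : ∀ {x : Matrix (Fin (n + 2)) (Fin (n + 2)) ℂ}, x.BlockTriangular id →
        C * x = x (Fin.last (n + 1)) (Fin.last (n + 1)) • C := by
      intro x hx
      ext i j
      rw [Matrix.mul_apply, Finset.sum_eq_single (Fin.last (n + 1))
        (fun k _ hk => by rw [hcol i k hk, zero_mul]) (by simp), Matrix.smul_apply, smul_eq_mul]
      by_cases hj : j = Fin.last (n + 1)
      · rw [hj, mul_comm]
      · have hlt : j < Fin.last (n + 1) := Fin.lt_last_iff_ne_last.2 hj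
        have hx0 : x (Fin.last (n + 1)) j = 0 := hx hlt
        rw [hx0, hcol i j hj, mul_zero, mul_zero]
    have strip : ∀ {z w : ℂ}, |z.im| < Real.pi → |w.im| < Real.pi →
        |(z - w).im| < 2 * Real.pi := by
      intro z w hz hw
      rw [Complex.sub_im]
      linarith [abs_sub z.im w.im]
    refine sub_eq_zero.1 (commutator_eq_zero_of_exp_add hC.symm (hleft ha) (hright ha)
      (hleft hb) (hright hb) (strip (ha' _) (ha' _)) (strip (hb' _) (hb' _)) ?_ h)
    -- α + β is the difference of two diagonal entries of a + b; this is where the strip for a + b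
    -- enters.
    rw [sub_add_sub_comm]
    exact strip (hab' _) (hab' _)

end Triangular

/-! ### Reduction to the triangular case -/

theorem IsPrincipalLog.conj {n : ℕ} {x a P : Matrix (Fin n) (Fin n) ℂ} (h : IsPrincipalLog x a)
    (hP : IsUnit P) : IsPrincipalLog (P⁻¹ * x * P) (P⁻¹ * a * P) := by
  refine ⟨by rw [Matrix.exp_conj' P a hP, h.1], ?_⟩
  obtain ⟨u, rfl⟩ := hP
  rw [← Matrix.coe_units_inv, spectrum.units_conjugate']
  exact h.2

theorem NoNonposEigenvalue.conj {n : ℕ} {x P : Matrix (Fin n) (Fin n) ℂ}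
    (h : NoNonposEigenvalue x) (hP : IsUnit P) : NoNonposEigenvalue (P⁻¹ * x * P) := by
  obtain ⟨u, rfl⟩ := hP
  intro t ht
  rw [← Matrix.coe_units_inv, spectrum.units_conjugate']
  exact h t ht

theorem theorem2 (n : ℕ) (x y : Matrix (Fin n) (Fin n) ℂ)
    (hx : NoNonposEigenvalue x) (hy : NoNonposEigenvalue y) (hxy : NoNonposEigenvalue (x * y))
    (hlog : principalLog (x * y) = principalLog x + principalLog y)
    (htri : SimultaneouslyTriangularizable x y) :
    x * y = y * x := by
  obtain ⟨P, hP, htx, hty⟩ := htri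
  have la := (isPrincipalLog_principalLog hx)
  have lb := (isPrincipalLog_principalLog hy)
  have lc := (isPrincipalLog_principalLog hxy)
  -- Now a + b is a principal logarithm of xy, which gives both e^(a+b) = e^a e^b and the strip for
  -- a + b.
  rw [hlog] at lc
  set a := principalLog x
  set b := principalLog y
  have la' := la.conj hP
  have lb' := lb.conj hP
  have lc' := lc.conj hP
  have ta := la'.blockTriangular (hx.conj hP) htx
  have tb := lb'.blockTriangular (hy.conj hP) hty
  have hadd : P⁻¹ * (a + b) * P = P⁻¹ * a * P + P⁻¹ * b * P := by rw [mul_add, add_mul]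
  rw [hadd] at lc'
  have hdet : IsUnit P.det := (Matrix.isUnit_iff_isUnit_det P).1 hP
  have hmul : ∀ u v : Matrix (Fin n) (Fin n) ℂ,
      P⁻¹ * (u * v) * P = P⁻¹ * u * P * (P⁻¹ * v * P) := by
    intro u v
    simp only [mul_assoc, Matrix.mul_nonsing_inv_cancel_left _ _ hdet]
  have strip : ∀ {c : Matrix (Fin n) (Fin n) ℂ}, c.BlockTriangular id →
      (∀ z ∈ spectrum ℂ c, -Real.pi < z.im ∧ z.im < Real.pi) → ∀ i, |(c i i).im| < Real.pi :=
    fun hc h i => abs_lt.2 (h _ (hc.diag_mem_spectrum i))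
  have hcomm := Matrix.BlockTriangular.mul_comm_of_exp_add n _ _ ta tb (strip ta la'.2)
    (strip tb lb'.2) (strip (ta.add tb) lc'.2) (by rw [la'.1, lb'.1, lc'.1, hmul])
  rw [← hmul, ← hmul] at hcomm
  have hab : Commute a b :=
    (Matrix.isUnit_nonsing_inv_iff.2 hP).mul_left_cancel (hP.mul_right_cancel hcomm)
  have he : Commute (NormedSpace.exp a) (NormedSpace.exp b) := hab.exp_left.exp_right
  rwa [la.1, lb.1] at he
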